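/- Let $T>0$ and let $\Omega$ be a linear space of real functions on $[0,T]$ (for instance $\Omega=C([0,T])$), with canonical process $X_t(\omega)=\omega_t$ and the $\sigma$-algebra generated by $X$; assume that $(t,\omega)\mapsto X_t(\omega)$ is jointly measurable. Let $\mathbb P$ be a probability measure on $\Omega$ under which $(X_t)_{t\in[0,T]}$ is a centered Gaussian process with covariance function $\gamma(s,t)=\mathbb E[X_sX_t]$, and let $\mu$ be a finite Borel measure on $[0,T]$. For $u\in\Omega$ let $\mathbb P_u$ be the translation of $\mathbb P$ by $u$, that is, the law of $X+u$ under $\mathbb P$, and let $\mathbb E_u$ be the expectation under $\mathbb P_u$. A drift estimator is any jointly measurable process $(\xi_t)_{t\in[0,T]}$ on $\Omega$ (no adaptedness is required). Then the estimator $\hat u=(X_t)_{t\in[0,T]}$ of the drift is minimax, that is, $$\sup_{v\in\Omega}\mathbb E_v\Big[\int_0^T|X_t-v_t|^2\,\mu(dt)\Big]=\inf_{\xi}\sup_{v\in\Omega}\mathbb E_v\Big[\int_0^T|\xi_t-v_t|^2\,\mu(dt)\Big],$$ and for every $u\in\Omega$, $$\int_0^T\gamma(t,t)\,\mu(dt)=\mathbb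 E_u\Big[\int_0^T|X_t-u_t|^2\,\mu(dt)\Big]=\inf_{\xi}\sup_{v\in\Omega}\mathbb E_v\Big[\int_0^T|\xi_t-v_t|^2\,\mu(dt)\Big],$$ where the infima are over all drift estimators and all quantities take values in $[0,\infty]$. -/

import Mathlib

open MeasureTheory ProbabilityTheory
open scoped ENNReal

namespace GaussianDrift

noncomputable section

/-- The time interval `[0, T]`. -/
abbrev TimeInterval (T : ℝ) : Type := Set.Icc (0 : ℝ) T

/-- The canonical process `X_t(ω) = ω_t` on a linear space `Ω` of real functions on `[0, T]`. Below,
`Ω` always carries the σ-algebra generated by `X`, that is, the trace of the product σ-algebra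
(this is the instance that Lean finds on the subtype `Ω`). -/
def canonicalProcess {T : ℝ} (Ω : Submodule ℝ (TimeInterval T → ℝ)) (t : TimeInterval T) (ω : Ω) : ℝ :=
  (ω : TimeInterval T → ℝ) t

/-- The σ-algebra on `Ω` is the one generated by the canonical process. -/
theorem measurableSpace_eq {T : ℝ} (Ω : Submodule ℝ (TimeInterval T → ℝ)) :
    (inferInstance : MeasurableSpace Ω) =
      ⨆ t, MeasurableSpace.comap (canonicalProcess Ω t) inferInstance := by
  change MeasurableSpace.comap Subtype.val MeasurableSpace.pi = _
  simp only [MeasurableSpace.pi, MeasurableSpace.comap_iSup, MeasurableSpace.comap_comp]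
  rfl

theorem measurable_translate {T : ℝ} (Ω : Submodule ℝ (TimeInterval T → ℝ)) (u : Ω) :
    Measurable (fun ω : Ω => ω + u) := by
  refine Measurable.subtype_mk (measurable_pi_lambda _ fun t => ?_)
  exact ((measurable_pi_apply t).comp measurable_subtype_coe).add_const _

/-- Under `P`, the canonical process is a centered Gaussian process with covariance function `γ`. -/
structure IsCenteredGaussian {T : ℝ} {Ω : Submodule ℝ (TimeInterval T → ℝ)}
    (γ : TimeInterval T → TimeInterval T → ℝ) (P : Measure Ω) : Prop where
  isGaussianProcess : IsGaussianProcess (canonicalProcess Ω) P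
  mean_eq_zero : ∀ t, ∫ ω, canonicalProcess Ω t ω ∂P = 0
  covariance_eq : ∀ s t, ∫ ω, canonicalProcess Ω s ω * canonicalProcess Ω t ω ∂P = γ s t

/-- `P_u`, the translation of `P` by the drift `u`: the law of `X + u` when `X` has law `P`. -/
def shiftedLaw {T : ℝ} {Ω : Submodule ℝ (TimeInterval T → ℝ)} (P : Measure Ω) (u : Ω) : Measure Ω :=
  P.map (fun ω => ω + u)

/-- A drift estimator `(ξ_t)`: any measurable process on `Ω`; no adaptedness is required. -/
def IsEstimator {T : ℝ} {Ω : Submodule ℝ (TimeInterval T → ℝ)} (ξ : TimeInterval T → Ω → ℝ) : Prop :=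
  Measurable (fun p : TimeInterval T × Ω => ξ p.1 p.2)

/-- The risk `E_v[∫ |ξ_t - v_t|² μ(dt)] ∈ [0, ∞]` of `ξ` at the drift `v`. -/
def risk {T : ℝ} {Ω : Submodule ℝ (TimeInterval T → ℝ)} (μ : Measure (TimeInterval T)) (P : Measure Ω)
    (ξ : TimeInterval T → Ω → ℝ) (v : Ω) : ℝ≥0∞ :=
  ∫⁻ ω, ∫⁻ t, ENNReal.ofReal (|ξ t ω - (v : TimeInterval T → ℝ) t| ^ 2) ∂μ ∂(shiftedLaw P v)

/-- `inf_ξ sup_v E_v[∫ |ξ_t - v_t|² μ(dt)]`, the infimum being over all estimators. -/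
def minimaxRisk {T : ℝ} {Ω : Submodule ℝ (TimeInterval T → ℝ)} (μ : Measure (TimeInterval T))
    (P : Measure Ω) : ℝ≥0∞ :=
  ⨅ (ξ : TimeInterval T → Ω → ℝ) (_ : IsEstimator ξ), ⨆ v : Ω, risk μ P ξ v

/-- `ξ` is an estimator whose worst-case risk is the smallest possible one. -/
def IsMinimax {T : ℝ} {Ω : Submodule ℝ (TimeInterval T → ℝ)} (μ : Measure (TimeInterval T))
    (P : Measure Ω) (ξ : TimeInterval T → Ω → ℝ) : Prop :=
  IsEstimator ξ ∧ ⨆ v : Ω, risk μ P ξ v = minimaxRisk μ P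

end

end GaussianDrift

/-!
The risk of the canonical process `X` is the constant `∫ γ(t,t) dμ`, by Tonelli. So the theorem
amounts to the Bayesian lower bound `∫ γ(t,t) dμ ≤ sup_v risk ξ v` for every estimator `ξ`.

As a prior for the drift take the law of `tan θ • Y`, where `Y` is an independent copy of `X`; it
lives on `Ω` because `P` does. The sample is then `X + tan θ • Y`. By the invariance of `P ⊗ P`
under rotations (`map_rotate_prod_self`), `X = cos θ • Z - sin θ • W` and
`Y = sin θ • Z + cos θ • W` with `Z`, `W` independent of law `P`. In these coordinates the sample is
`(cos θ)⁻¹ • Z`, a function of `Z` alone, while the drift is a function of `Z` plus `sin θ • W`.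
Since `W` is centered and independent of `Z`, the mean squared error at time `t` is at least
`sin² θ * γ(t,t)`, whatever the estimator. The average of the risk over the prior bounds its supremum
from below, so `sin² θ * ∫ γ(t,t) dμ ≤ sup_v risk ξ v` (`sin_sq_mul_le_iSup_risk`), and `θ → π/2`
concludes. No finiteness of `∫ γ(t,t) dμ` is needed.
-/

namespace GaussianDrift

variable {T : ℝ} {Ω : Submodule ℝ (TimeInterval T → ℝ)}

/-! ### Measurable structure of the path space -/

theorem measurable_canonicalProcess (t : TimeInterval T) : Measurable (canonicalProcess Ω t) :=
  (measurable_pi_apply t).comp measurable_subtype_coe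

theorem canonicalProcess_smul (t : TimeInterval T) (a : ℝ) (ω : Ω) :
    canonicalProcess Ω t (a • ω) = a * canonicalProcess Ω t ω :=
  rfl

theorem measurable_linearCombination (a b : ℝ) :
    Measurable (fun p : Ω × Ω => a • p.1 + b • p.2) := by
  refine Measurable.subtype_mk (measurable_pi_lambda _ fun t => ?_)
  exact (((measurable_canonicalProcess t).comp measurable_fst).const_mul a).add
    (((measurable_canonicalProcess t).comp measurable_snd).const_mul b)

/-- The rotation of `Ω × Ω` by the angle `θ`. The path space carries no norm here, so
`ContinuousLinearMap.rotation` does not apply to it; the sign convention is the same. -/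
noncomputable def rotate (θ : ℝ) (p : Ω × Ω) : Ω × Ω :=
  (Real.cos θ • p.1 + Real.sin θ • p.2, -Real.sin θ • p.1 + Real.cos θ • p.2)

theorem measurable_rotate (θ : ℝ) : Measurable (rotate (Ω := Ω) θ) :=
  (measurable_linearCombination _ _).prodMk (measurable_linearCombination _ _)

/-- The values of a path at finitely many times. -/
def evalFinset (I : Finset (TimeInterval T)) (ω : Ω) : I → ℝ :=
  I.restrict (canonicalProcess Ω · ω)

theorem measurable_evalFinset (I : Finset (TimeInterval T)) :
    Measurable (evalFinset (Ω := Ω) I) :=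
  measurable_pi_lambda _ fun t => measurable_canonicalProcess t.1

/-- The events that depend on finitely many times. -/
def finiteDimEvents (Ω : Submodule ℝ (TimeInterval T → ℝ)) : Set (Set Ω) :=
  {A | ∃ s ∈ measurableCylinders (fun _ : TimeInterval T => ℝ), Subtype.val ⁻¹' s = A}

theorem isPiSystem_finiteDimEvents : IsPiSystem (finiteDimEvents Ω) :=
  isPiSystem_measurableCylinders.comap _

theorem generateFrom_finiteDimEvents :
    MeasurableSpace.generateFrom (finiteDimEvents Ω) = (inferInstance : MeasurableSpace Ω) := by
  change MeasurableSpace.generateFrom (Set.preimage Subtype.val '' _) =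
    MeasurableSpace.comap Subtype.val MeasurableSpace.pi
  rw [← MeasurableSpace.comap_generateFrom, generateFrom_measurableCylinders]

theorem univ_mem_finiteDimEvents : Set.univ ∈ finiteDimEvents Ω :=
  ⟨Set.univ, univ_mem_measurableCylinders _, Set.preimage_univ⟩

/-- Two cylinder events can be read off from the same finite set of times. -/
theorem exists_evalFinset_preimage {A B : Set Ω} (hA : A ∈ finiteDimEvents Ω)
    (hB : B ∈ finiteDimEvents Ω) :
    ∃ (I : Finset (TimeInterval T)) (S S' : Set (I → ℝ)), MeasurableSet S ∧ MeasurableSet S' ∧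
      A = evalFinset I ⁻¹' S ∧ B = evalFinset I ⁻¹' S' := by
  classical
  obtain ⟨s, hs, rfl⟩ := hA
  obtain ⟨s', hs', rfl⟩ := hB
  obtain ⟨I, S, hS, rfl⟩ := (mem_measurableCylinders _).1 hs
  obtain ⟨J, S', hS', rfl⟩ := (mem_measurableCylinders _).1 hs'
  exact ⟨I ∪ J, Finset.restrict₂ (π := fun _ => ℝ) Finset.subset_union_left ⁻¹' S,
    Finset.restrict₂ (π := fun _ => ℝ) Finset.subset_union_right ⁻¹' S',
    Finset.measurable_restrict₂ _ hS, Finset.measurable_restrict₂ _ hS', rfl, rfl⟩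

/-! ### Rotation invariance of the Gaussian law -/

section Gaussian

variable {γ : TimeInterval T → TimeInterval T → ℝ} {P : Measure Ω}

theorem IsCenteredGaussian.isGaussian_map (hP : IsCenteredGaussian γ P)
    (I : Finset (TimeInterval T)) : IsGaussian (P.map (evalFinset I)) :=
  (hP.isGaussianProcess.hasGaussianLaw I).isGaussian_map

theorem IsCenteredGaussian.memLp_two (hP : IsCenteredGaussian γ P) (t : TimeInterval T) :
    MemLp (canonicalProcess Ω t) 2 P :=
  (hP.isGaussianProcess.hasGaussianLaw_eval t).memLp_two

theorem IsCenteredGaussian.integral_dual_map (hP : IsCenteredGaussian γ P)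
    (I : Finset (TimeInterval T)) (L : StrongDual ℝ (I → ℝ)) :
    ∫ x, L x ∂(P.map (evalFinset I)) = 0 := by
  have hint : Integrable (evalFinset I) P := (hP.isGaussianProcess.hasGaussianLaw I).integrable
  rw [integral_map (measurable_evalFinset I).aemeasurable (by fun_prop),
    L.integral_comp_comm hint]
  have h0 : ∫ ω, evalFinset I ω ∂P = 0 := by
    ext i
    refine (eval_integral (fun j => ?_) i).trans (hP.mean_eq_zero i)
    exact (hP.isGaussianProcess.hasGaussianLaw_eval j.1).integrable
  rw [h0, map_zero]

/-- Two independent copies of a centered Gaussian process may be rotated without changing their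
joint law. It suffices to check this on finitely many times, where it is a property of centered
Gaussian vectors. -/
theorem map_rotate_prod_self [IsProbabilityMeasure P] (hP : IsCenteredGaussian γ P) (θ : ℝ) :
    (P.prod P).map (rotate θ) = P.prod P := by
  let hspan : P.FiniteSpanningSetsIn (finiteDimEvents Ω) :=
    ⟨fun _ => Set.univ, fun _ => univ_mem_finiteDimEvents, fun _ => measure_lt_top _ _,
      Set.iUnion_const _⟩
  refine (Measure.prod_eq_generateFrom generateFrom_finiteDimEvents generateFrom_finiteDimEvents
    isPiSystem_finiteDimEvents isPiSystem_finiteDimEvents hspan hspan fun A hA B hB => ?_).symm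
  obtain ⟨I, S, S', hS, hS', rfl, rfl⟩ := exists_evalFinset_preimage hA hB
  have hI := measurable_evalFinset (Ω := Ω) I
  have := hP.isGaussian_map I
  have hrot := IsGaussian.map_rotation_eq_self_of_forall_strongDual_eq_zero
    (hP.integral_dual_map I) θ
  have hpre : rotate θ ⁻¹' ((evalFinset I ⁻¹' S) ×ˢ (evalFinset I ⁻¹' S')) =
      Prod.map (evalFinset (Ω := Ω) I) (evalFinset I) ⁻¹'
        (ContinuousLinearMap.rotation θ ⁻¹' (S ×ˢ S')) := rfl
  have hmeas : Measurable (ContinuousLinearMap.rotation (E := I → ℝ) θ) := by fun_prop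
  rw [Measure.map_apply (measurable_rotate θ) ((hI hS).prod (hI hS')), hpre,
    ← Measure.map_apply (hI.prodMap hI) (hmeas (hS.prod hS')),
    ← Measure.map_prod_map _ _ hI hI, ← Measure.map_apply hmeas (hS.prod hS'), hrot,
    Measure.prod_prod, Measure.map_apply hI hS, Measure.map_apply hI hS']

/-- A centered Gaussian variable cannot be brought closer to `0` by adding a constant. -/
theorem IsCenteredGaussian.le_lintegral_sq [IsProbabilityMeasure P] (hP : IsCenteredGaussian γ P)
    (t : TimeInterval T) (a b : ℝ) :
    ENNReal.ofReal (b ^ 2 * γ t t) ≤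
      ∫⁻ ω, ENNReal.ofReal (|a - b * canonicalProcess Ω t ω| ^ 2) ∂P := by
  have hL2 : Integrable (fun ω => canonicalProcess Ω t ω ^ 2) P := (hP.memLp_two t).integrable_sq
  have hL1 : Integrable (canonicalProcess Ω t) P := (hP.memLp_two t).integrable one_le_two
  have hsplit : (fun ω => |a - b * canonicalProcess Ω t ω| ^ 2) = fun ω =>
      (a ^ 2 - 2 * a * b * canonicalProcess Ω t ω) + b ^ 2 * canonicalProcess Ω t ω ^ 2 := by
    funext ω
    rw [sq_abs]
    ring
  have hint1 : Integrable (fun ω => a ^ 2 - 2 * a * b * canonicalProcess Ω t ω) P :=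
    (integrable_const _).sub (hL1.const_mul _)
  have hint : Integrable (fun ω => |a - b * canonicalProcess Ω t ω| ^ 2) P := by
    rw [hsplit]
    exact hint1.add (hL2.const_mul _)
  have hvar : ∫ ω, canonicalProcess Ω t ω ^ 2 ∂P = γ t t := by
    simpa only [sq] using hP.covariance_eq t t
  rw [← ofReal_integral_eq_lintegral_ofReal hint (Filter.Eventually.of_forall fun _ => by positivity)]
  refine ENNReal.ofReal_le_ofReal ?_
  rw [hsplit, integral_add hint1 (hL2.const_mul _), integral_sub (integrable_const _)
    (hL1.const_mul _), integral_const_mul, integral_const_mul, hP.mean_eq_zero, hvar]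
  simp only [integral_const, probReal_univ, one_smul, mul_zero, sub_zero]
  nlinarith [sq_nonneg a]

/-! ### The risk -/

variable {μ : Measure (TimeInterval T)}

theorem risk_eq [IsFiniteMeasure μ]
    (hΩ : Measurable (fun p : TimeInterval T × Ω => canonicalProcess Ω p.1 p.2))
    {ξ : TimeInterval T → Ω → ℝ} (hξ : IsEstimator ξ) (v : Ω) :
    risk μ P ξ v = ∫⁻ ω, ∫⁻ t,
      ENNReal.ofReal (|ξ t (ω + v) - canonicalProcess Ω t v| ^ 2) ∂μ ∂P := by
  have hv : Measurable (fun t => canonicalProcess Ω t v) := hΩ.comp measurable_prodMk_right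
  have hm : Measurable (fun p : Ω × TimeInterval T =>
      ENNReal.ofReal (|ξ p.2 p.1 - canonicalProcess Ω p.2 v| ^ 2)) :=
    ((Measurable.sub (hξ.comp measurable_swap) (hv.comp measurable_snd)).abs.pow_const 2).ennreal_ofReal
  exact lintegral_map hm.lintegral_prod_right' (measurable_translate Ω v)

theorem risk_canonicalProcess [IsProbabilityMeasure P] [IsFiniteMeasure μ]
    (hΩ : Measurable (fun p : TimeInterval T × Ω => canonicalProcess Ω p.1 p.2))
    (hP : IsCenteredGaussian γ P) (u : Ω) :
    risk μ P (canonicalProcess Ω) u = ∫⁻ t, ENNReal.ofReal (γ t t) ∂μ := by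
  have hsub : ∀ ω t, canonicalProcess Ω t (ω + u) - canonicalProcess Ω t u =
      canonicalProcess Ω t ω := fun ω t => add_sub_cancel_right _ _
  rw [risk_eq hΩ hΩ]
  simp only [hsub, sq_abs]
  rw [lintegral_lintegral_swap]
  · refine lintegral_congr fun t => ?_
    rw [← ofReal_integral_eq_lintegral_ofReal (hP.memLp_two t).integrable_sq
      (Filter.Eventually.of_forall fun _ => by positivity), ← hP.covariance_eq t t]
    simp only [sq]
  · exact ((hΩ.comp measurable_swap).pow_const 2).ennreal_ofReal.aemeasurable

/-- The Bayes lower bound for the prior `tan θ • Y`, with `Y` an independent copy of `X`. -/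
theorem sin_sq_mul_le_iSup_risk [IsProbabilityMeasure P] [IsFiniteMeasure μ]
    (hΩ : Measurable (fun p : TimeInterval T × Ω => canonicalProcess Ω p.1 p.2))
    (hP : IsCenteredGaussian γ P) {ξ : TimeInterval T → Ω → ℝ} (hξ : IsEstimator ξ)
    {θ : ℝ} (hθ : Real.cos θ ≠ 0) :
    ENNReal.ofReal (Real.sin θ ^ 2) * ∫⁻ t, ENNReal.ofReal (γ t t) ∂μ ≤ ⨆ v, risk μ P ξ v := by
  set c := Real.cos θ
  set s := Real.sin θ
  have hcs : s ^ 2 + c ^ 2 = 1 := Real.sin_sq_add_cos_sq θ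
  -- the loss, as a function of the noise `p.1`, of the prior variable `p.2` and of the time
  let F : (Ω × Ω) × TimeInterval T → ℝ≥0∞ := fun q =>
    ENNReal.ofReal (|ξ q.2 (q.1.1 + (s / c) • q.1.2) - s / c * canonicalProcess Ω q.2 q.1.2| ^ 2)
  have hF : Measurable F := by
    have h1 : Measurable (fun q : (Ω × Ω) × TimeInterval T => q.1.1 + (s / c) • q.1.2) := by
      simpa only [one_smul, Function.comp_def] using
        (measurable_linearCombination (Ω := Ω) 1 (s / c)).comp measurable_fst
    have h2 : Measurable (fun q : (Ω × Ω) × TimeInterval T => canonicalProcess Ω q.2 q.1.2) :=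
      hΩ.comp (measurable_snd.prodMk measurable_fst.snd)
    exact (((Measurable.comp hξ (measurable_snd.prodMk h1)).sub (h2.const_mul _)).abs.pow_const
      2).ennreal_ofReal
  have hG : Measurable (fun p => ∫⁻ t, F (p, t) ∂μ) := hF.lintegral_prod_right'
  have hrot := measurable_rotate (Ω := Ω) (-θ)
  -- in the rotated coordinates the sample does not depend on `w`
  have hFrot : ∀ z w t, F (rotate (-θ) (z, w), t) = ENNReal.ofReal
      (|(ξ t (c⁻¹ • z) - s ^ 2 / c * canonicalProcess Ω t z) - s * canonicalProcess Ω t w| ^ 2) := by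
    intro z w t
    have hsample : (rotate (-θ) (z, w)).1 + (s / c) • (rotate (-θ) (z, w)).2 = c⁻¹ • z := by
      ext r
      simp only [rotate, Real.cos_neg, Real.sin_neg, neg_neg, Submodule.coe_add,
        Submodule.coe_smul, Pi.add_apply, Pi.smul_apply, smul_eq_mul]
      change (c * z.1 r + -s * w.1 r) + s / c * (s * z.1 r + c * w.1 r) = c⁻¹ * z.1 r
      field_simp
      linear_combination (z.1 r) * hcs
    have hdrift : s / c * canonicalProcess Ω t (rotate (-θ) (z, w)).2 =
        s ^ 2 / c * canonicalProcess Ω t z + s * canonicalProcess Ω t w := by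
      simp only [rotate, canonicalProcess, Real.cos_neg, Real.sin_neg, neg_neg, Submodule.coe_add,
        Submodule.coe_smul, Pi.add_apply, Pi.smul_apply, smul_eq_mul]
      change s / c * (s * z.1 t + c * w.1 t) = s ^ 2 / c * z.1 t + s * w.1 t
      field_simp
    simp only [F]
    rw [hsample, hdrift, sub_add_eq_sub_sub]
  calc ENNReal.ofReal (s ^ 2) * ∫⁻ t, ENNReal.ofReal (γ t t) ∂μ
      = ∫⁻ _ : Ω, ∫⁻ t, ENNReal.ofReal (s ^ 2 * γ t t) ∂μ ∂P := by
        simp_rw [ENNReal.ofReal_mul (sq_nonneg s)]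
        rw [lintegral_const_mul' _ _ ENNReal.ofReal_ne_top, lintegral_const, measure_univ, mul_one]
    _ ≤ ∫⁻ z, ∫⁻ t, ∫⁻ w, F (rotate (-θ) (z, w), t) ∂P ∂μ ∂P := by
        refine lintegral_mono fun z => lintegral_mono fun t => ?_
        simp only [hFrot]
        exact hP.le_lintegral_sq t _ s
    _ = ∫⁻ z, ∫⁻ w, ∫⁻ t, F (rotate (-θ) (z, w), t) ∂μ ∂P ∂P := by
        refine lintegral_congr fun z => lintegral_lintegral_swap ?_
        exact (hF.comp ((hrot.comp (measurable_const.prodMk measurable_snd)).prodMk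
          measurable_fst)).aemeasurable
    _ = ∫⁻ p, ∫⁻ t, F (rotate (-θ) p, t) ∂μ ∂(P.prod P) :=
        (lintegral_prod _ (hG.comp hrot).aemeasurable).symm
    _ = ∫⁻ p, ∫⁻ t, F (p, t) ∂μ ∂(P.prod P) := by
        rw [← lintegral_map hG hrot, map_rotate_prod_self hP]
    _ = ∫⁻ y, risk μ P ξ ((s / c) • y) ∂P := by
        rw [lintegral_prod_symm _ hG.aemeasurable]
        refine lintegral_congr fun y => ?_
        rw [risk_eq hΩ hξ]
        simp only [F, canonicalProcess_smul]
    _ ≤ ∫⁻ _ : Ω, ⨆ v, risk μ P ξ v ∂P := lintegral_mono fun y => le_iSup (risk μ P ξ) _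
    _ = ⨆ v, risk μ P ξ v := by rw [lintegral_const, measure_univ, mul_one]

theorem le_iSup_risk [IsProbabilityMeasure P] [IsFiniteMeasure μ]
    (hΩ : Measurable (fun p : TimeInterval T × Ω => canonicalProcess Ω p.1 p.2))
    (hP : IsCenteredGaussian γ P) {ξ : TimeInterval T → Ω → ℝ} (hξ : IsEstimator ξ) :
    ∫⁻ t, ENNReal.ofReal (γ t t) ∂μ ≤ ⨆ v, risk μ P ξ v := by
  have hlim : Filter.Tendsto (fun θ => ENNReal.ofReal (Real.sin θ ^ 2))
      (nhdsWithin (Real.pi / 2) (Set.Iio (Real.pi / 2))) (nhds 1) := by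
    have h : Continuous fun θ => ENNReal.ofReal (Real.sin θ ^ 2) :=
      ENNReal.continuous_ofReal.comp (Real.continuous_sin.pow 2)
    simpa using (h.tendsto (Real.pi / 2)).mono_left nhdsWithin_le_nhds
  -- the limit factor `1` is not `0`, so the integral may be infinite
  have hmul := ENNReal.Tendsto.mul_const (b := ∫⁻ t, ENNReal.ofReal (γ t t) ∂μ) hlim
    (Or.inl one_ne_zero)
  rw [one_mul] at hmul
  refine le_of_tendsto hmul ?_
  filter_upwards [Ioo_mem_nhdsLT (show -(Real.pi / 2) < Real.pi / 2 by linarith [Real.pi_pos])]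
    with θ hθ
  exact sin_sq_mul_le_iSup_risk hΩ hP hξ (Real.cos_pos_of_mem_Ioo hθ).ne'

theorem minimaxRisk_eq [IsProbabilityMeasure P] [IsFiniteMeasure μ]
    (hΩ : Measurable (fun p : TimeInterval T × Ω => canonicalProcess Ω p.1 p.2))
    (hP : IsCenteredGaussian γ P) :
    minimaxRisk μ P = ∫⁻ t, ENNReal.ofReal (γ t t) ∂μ := by
  refine le_antisymm ?_ (le_iInf₂ fun ξ hξ => le_iSup_risk hΩ hP hξ)
  exact (iInf₂_le (canonicalProcess Ω) hΩ).trans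
    (iSup_le fun v => (risk_canonicalProcess hΩ hP v).le)

end Gaussian

end GaussianDrift

theorem proposition3p2 (T : ℝ) (hT : 0 < T)
    (Ω : Submodule ℝ (GaussianDrift.TimeInterval T → ℝ))
    (hΩ : Measurable (fun p : GaussianDrift.TimeInterval T × Ω =>
      GaussianDrift.canonicalProcess Ω p.1 p.2))
    (γ : GaussianDrift.TimeInterval T → GaussianDrift.TimeInterval T → ℝ)
    (P : Measure Ω) [IsProbabilityMeasure P]
    (hP : GaussianDrift.IsCenteredGaussian γ P)
    (μ : Measure (GaussianDrift.TimeInterval T)) [IsFiniteMeasure μ] :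
    GaussianDrift.IsMinimax μ P (GaussianDrift.canonicalProcess Ω) ∧
    ∀ u : Ω,
      GaussianDrift.risk μ P (GaussianDrift.canonicalProcess Ω) u
        = ∫⁻ t, ENNReal.ofReal (γ t t) ∂μ ∧
      GaussianDrift.risk μ P (GaussianDrift.canonicalProcess Ω) u
        = GaussianDrift.minimaxRisk μ P := by
  have hrisk := GaussianDrift.risk_canonicalProcess (μ := μ) hΩ hP
  have hminimax := GaussianDrift.minimaxRisk_eq (μ := μ) hΩ hP
  refine ⟨⟨hΩ, ?_⟩, fun u => ⟨hrisk u, (hrisk u).trans hminimax.symm⟩⟩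
  simp only [hrisk, ciSup_const, hminimax]
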